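/- Let $p$ be a prime, $\mathbb K$ a field of characteristic $p$, and $n>1$ an integer not divisible by $p$ (for example, $p>n>1$). Let $\kappa\in\mathbb K\setminus\mathbb F_p$, where $\mathbb F_p\subset\mathbb K$ is the prime field. Let $L=\mathbb Kv_1\oplus\mathbb Kv_2$ be the two-dimensional representation of $\mathfrak{sl}_2$, with $ev_1=0$, $ev_2=v_1$. Let $L^{\otimes n}[n-2]\subset L^{\otimes n}$ be the span of the vectors $v_1\otimes\cdots\otimes v_2\otimes\cdots\otimes v_1$ with exactly one factor $v_2$, and let $V=\operatorname{Sing}L^{\otimes n}[n-2]$ be the subspace of those vectors in $L^{\otimes n}[n-2]$ that are annihilated by $e$. Put $R^{(i,j)}(u)=\dfrac{u-P^{(i,j)}}{u-1}$, where $P^{(i,j)}$ is the permutation of the $i$-th and $j$-th factors of $L^{\otimes n}$, and for $a=1,\dots,n$ put \[ K_a(z;\kappa)=R^{(a,a-1)}(z_a-z_{a-1}-\kappa)\cdots R^{(a,1)}(z_a-z_1-\kappa)\,R^{(a,n)}(z_a-z_n)\cdots R^{(a,a+1)}(z_a-z_{a+1}). \] Then there is no nonzero rational $V$-valued function $f(z_1,\dots,z_n)$,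 that is, no nonzero element $f\in\mathbb K(z_1,\dots,z_n)\otimes_{\mathbb K}V$, that solves the qKZ equations with step $\kappa$, \[ f(z_1,\dots,z_a-\kappa,\dots,z_n)=K_a(z;\kappa)\,f(z_1,\dots,z_n),\qquad a=1,\dots,n . \] -/

import Mathlib

open scoped TensorProduct

noncomputable section

namespace QKZ

/-! ### The `sl₂`-module `L^{⊗ n}` -/

section Tensor

variable (K : Type*) [Field K]

/-- The two-dimensional space `L` with basis `v₁, v₂`. -/
abbrev L : Type _ := Fin 2 → K

/-- The basis vector `v₁` of `L`. -/
def v₁ : L K := Pi.single 0 1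

/-- The basis vector `v₂` of `L`. -/
def v₂ : L K := Pi.single 1 1

/-- The action of the generator `e` of `sl₂` on `L`: `e v₁ = 0`, `e v₂ = v₁`. -/
def eL : L K →ₗ[K] L K :=
  (LinearMap.proj 1).smulRight (v₁ K)

variable (n : ℕ)

/-- The tensor power `L^{⊗ n}`, with tensor factors numbered by `Fin n`. -/
abbrev TensorPow : Type _ := ⨂[K] _ : Fin n, L K

variable {n}

/-- The vector `v_I = v_{i₁} ⊗ ⋯ ⊗ v_{iₙ}`, where `i_j = 2` if `j ∈ I` and `i_j = 1` otherwise. -/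
def vI (I : Finset (Fin n)) : TensorPow K n :=
  PiTensorProduct.tprod K (fun j => if j ∈ I then v₂ K else v₁ K)

variable (n)

/-- The action of `e` on `L^{⊗ n}`: the sum over `j` of the operators acting as `e` on the `j`-th
factor and as the identity on the other factors. -/
def eTensor : TensorPow K n →ₗ[K] TensorPow K n :=
  ∑ j : Fin n, PiTensorProduct.map
    (Function.update (fun _ : Fin n => (LinearMap.id : L K →ₗ[K] L K)) j (eL K))

/-- The weight subspace `L^{⊗ n}[n - 2l]`: the span of the `v_I` with `|I| = l`. -/
def weightSpace (l : ℕ) : Submodule K (TensorPow K n) :=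
  Submodule.span K {w | ∃ I : Finset (Fin n), I.card = l ∧ vI K I = w}

/-- The space `Sing L^{⊗ n}[n - 2l]` of singular vectors of weight `n - 2l`. -/
def sing (l : ℕ) : Submodule K (TensorPow K n) :=
  weightSpace K n l ⊓ LinearMap.ker (eTensor K n)

variable {n}

/-- The permutation `P^{(i,j)}` of the `i`-th and `j`-th tensor factors of `L^{⊗ n}`. -/
def perm (i j : Fin n) : TensorPow K n →ₗ[K] TensorPow K n :=
  (PiTensorProduct.reindex K (fun _ : Fin n => L K) (Equiv.swap i j)).toLinearMap

end Tensor

/-! ### Rational functions in `z₁, …, zₙ` and their translations -/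

section Rational

variable (K : Type*) [Field K] (n : ℕ)

/-- The field `K(z₁, …, zₙ)` of rational functions. -/
abbrev RatFun : Type _ := FractionRing (MvPolynomial (Fin n) K)

variable {K n}

/-- The coordinate function `z_a`. -/
def z (a : Fin n) : RatFun K n :=
  algebraMap (MvPolynomial (Fin n) K) (RatFun K n) (MvPolynomial.X a)

/-- The substitution `z_a ↦ z_a - κ` (other variables unchanged) on polynomials. -/
def polyShiftHom (κ : K) (a : Fin n) : MvPolynomial (Fin n) K →ₐ[K] MvPolynomial (Fin n) K :=
  MvPolynomial.aeval fun i =>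
    MvPolynomial.X i - if i = a then MvPolynomial.C κ else 0

lemma polyShiftHom_comp (κ μ : K) (h : κ + μ = 0) (a : Fin n) :
    (polyShiftHom κ a).comp (polyShiftHom μ a) = AlgHom.id K _ := by
  have hμ : μ = -κ := by linear_combination h
  subst hμ
  refine MvPolynomial.algHom_ext fun i => ?_
  by_cases hi : i = a <;> simp [polyShiftHom, hi]

/-- The substitution `z_a ↦ z_a - κ` as an automorphism of the polynomial ring. -/
def polyShift (κ : K) (a : Fin n) : MvPolynomial (Fin n) K ≃ₐ[K] MvPolynomial (Fin n) K :=
  AlgEquiv.ofAlgHom (polyShiftHom κ a) (polyShiftHom (-κ) a)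
    (polyShiftHom_comp κ (-κ) (by ring) a) (polyShiftHom_comp (-κ) κ (by ring) a)

/-- The translation `g(z₁, …, zₙ) ↦ g(z₁, …, z_a - κ, …, zₙ)` of rational functions. -/
def shift (κ : K) (a : Fin n) : RatFun K n ≃ₐ[K] RatFun K n :=
  IsFractionRing.fieldEquivOfAlgEquiv K (RatFun K n) (RatFun K n) (polyShift κ a)

end Rational

/-! ### The qKZ equations -/

section Equations

variable (K : Type*) [Field K] (n : ℕ)

/-- Rational `L^{⊗ n}`-valued functions of `z₁, …, zₙ`. -/
abbrev VecFun : Type _ := RatFun K n ⊗[K] TensorPow K n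

variable {K n}

/-- The `R`-matrix `R^{(i,j)}(u) = (u - P^{(i,j)}) / (u - 1)` acting on the `i`-th and `j`-th
tensor factors, for a rational function `u`. -/
def R (i j : Fin n) (u : RatFun K n) : Module.End (RatFun K n) (VecFun K n) :=
  (u - 1)⁻¹ • (u • (1 : Module.End (RatFun K n) (VecFun K n)) -
    (perm K i j).baseChange (RatFun K n))

/-- The qKZ operator
`K_a(z; κ) = R^{(a,a-1)}(z_a - z_{a-1} - κ) ⋯ R^{(a,1)}(z_a - z_1 - κ)
  R^{(a,n)}(z_a - z_n) ⋯ R^{(a,a+1)}(z_a - z_{a+1})`. -/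
def qKZOp (κ : K) (a : Fin n) : Module.End (RatFun K n) (VecFun K n) :=
  ((((List.finRange n).filter (fun j => j < a)).reverse.map
      fun j => R a j (z a - z j - algebraMap K (RatFun K n) κ)).prod) *
  ((((List.finRange n).filter (fun j => a < j)).reverse.map
      fun j => R a j (z a - z j)).prod)

/-- The translation `s(z₁, …, zₙ) ↦ s(z₁, …, z_a - κ, …, zₙ)` of rational `L^{⊗ n}`-valued
functions. -/
def vecShift (κ : K) (a : Fin n) : VecFun K n →ₗ[K] VecFun K n :=
  LinearMap.rTensor (TensorPow K n) (shift κ a).toLinearMap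

/-- `s` is a solution of the qKZ equations with step `κ`:
`s(z₁, …, z_a - κ, …, zₙ) = K_a(z; κ) s(z)` for all `a`. -/
def IsSolution (κ : K) (s : VecFun K n) : Prop :=
  ∀ a : Fin n, vecShift κ a s = qKZOp κ a s

variable (K n)

/-- The rational functions with values in `V = Sing L^{⊗ n}[n - 2]`, as a subspace of the rational
`L^{⊗ n}`-valued functions. -/
def singFun : Submodule (RatFun K n) (VecFun K n) :=
  (sing K n 1).baseChange (RatFun K n)

end Equations

end QKZ

end

noncomputable section

namespace QKZ

/-! ### The degree valuation in one variable -/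

section Degree

open WithZero

/-! The obstruction sits at infinity in the first variable. For the first index `a` the operator
`qKZOp κ a` has no factors with shifted argument, and as `z a` tends to infinity it is `1 + (z a)⁻¹
∑_j (1 - P^{(a,j)})` up to second order (`degLE_coordFun_prod_R`). A function of degree `d` in `z a`
satisfies `g(z_a - κ) = g - d κ g / z_a` up to relative order `-2` (`DegLE.shiftExpansion`).
Comparing the two, the leading coefficient of a solution is killed by `∑_j (1 - P^{(a,j)}) + d κ`.

On singular vectors the coordinates sum to zero, so `∑_j (1 - P^{(a,j)})` is triangular: it
multiplies the `a`-th coordinate by `n`, and sends any other coordinate `f i` to `f i - f a`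
(`sum_sub_swap_self`, `sum_sub_swap_of_ne`). Since `κ` lies outside the prime field and `p ∤ n`,
neither `n + d κ` nor `1 + d κ` vanishes, even when `p` divides `d`. Hence the leading coefficient
is zero, which is absurd. Leading coefficients are never extracted: each such equation is stated as
a drop in the degree valuation. -/

/-- The valuation on polynomials given by the degree in the variable `X_a`. -/
def polyDegreeValuation (K : Type*) [Field K] {n : ℕ} (a : Fin n) :
    Valuation (MvPolynomial (Fin n) K) (WithZero (Multiplicative ℤ)) := by
  classical
  exact
  { toFun := fun P => if P = 0 then 0 else exp (P.degreeOf a : ℤ)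
    map_zero' := by simp
    map_one' := by simp
    map_mul' := fun P Q => by
      by_cases hP : P = 0
      · simp [hP]
      by_cases hQ : Q = 0
      · simp [hQ]
      simp only [hP, hQ, mul_eq_zero, or_self, if_false]
      rw [MvPolynomial.degreeOf_mul_eq hP hQ, Nat.cast_add, exp_add]
    map_add_le_max' := fun P Q => by
      by_cases hP : P = 0
      · simp [hP]
      by_cases hQ : Q = 0
      · simp [hQ]
      by_cases hPQ : P + Q = 0
      · simp [hPQ]
      simp only [hP, hQ, hPQ, if_false, le_max_iff, exp_le_exp, Nat.cast_le]
      exact le_max_iff.1 (MvPolynomial.degreeOf_add_le a P Q) }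

variable {K : Type*} [Field K] {n : ℕ}

lemma polyDegreeValuation_apply (a : Fin n) {P : MvPolynomial (Fin n) K} (hP : P ≠ 0) :
    polyDegreeValuation K a P = exp (P.degreeOf a : ℤ) :=
  if_neg hP

lemma polyDegreeValuation_le (a : Fin n) (P : MvPolynomial (Fin n) K) :
    polyDegreeValuation K a P ≤ exp (P.degreeOf a : ℤ) := by
  by_cases hP : P = 0
  · simp [hP]
  · exact (polyDegreeValuation_apply a hP).le

/-- The valuation on rational functions given by the degree in the variable `z_a`. -/
def degreeValuation (K : Type*) [Field K] {n : ℕ} (a : Fin n) :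
    Valuation (RatFun K n) (WithZero (Multiplicative ℤ)) :=
  (polyDegreeValuation K a).extendToLocalization
    (S := nonZeroDivisors (MvPolynomial (Fin n) K)) (fun P hP h => by
      have hP' := nonZeroDivisors.ne_zero hP
      have h0 : polyDegreeValuation K a P = 0 := h
      rw [polyDegreeValuation_apply a hP'] at h0
      exact exp_ne_zero h0) (RatFun K n)

lemma degreeValuation_algebraMap (a : Fin n) (P : MvPolynomial (Fin n) K) :
    degreeValuation K a (algebraMap _ (RatFun K n) P) = polyDegreeValuation K a P :=
  Valuation.extendToLocalization_apply_map_apply ..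

/-- `DegLE a k g` says that the degree of `g` in `z_a` is at most `k`. -/
def DegLE (a : Fin n) (k : ℤ) (g : RatFun K n) : Prop :=
  degreeValuation K a g ≤ exp k

variable {a : Fin n} {k l : ℤ} {g h : RatFun K n}

lemma DegLE.mono (hg : DegLE a k g) (hkl : k ≤ l) : DegLE a l g :=
  le_trans hg (exp_le_exp.2 hkl)

lemma DegLE.add (hg : DegLE a k g) (hh : DegLE a k h) : DegLE a k (g + h) :=
  Valuation.map_add_le _ hg hh

lemma DegLE.sub (hg : DegLE a k g) (hh : DegLE a k h) : DegLE a k (g - h) :=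
  (Valuation.map_sub _ g h).trans (max_le hg hh)

lemma DegLE.mul (hg : DegLE a k g) (hh : DegLE a l h) : DegLE a (k + l) (g * h) := by
  unfold DegLE
  rw [map_mul, exp_add]
  exact mul_le_mul' hg hh

lemma DegLE.zero : DegLE a k (0 : RatFun K n) := by
  simp [DegLE]

lemma DegLE.sum {ι : Type*} {s : Finset ι} {f : ι → RatFun K n}
    (hf : ∀ i ∈ s, DegLE a k (f i)) : DegLE a k (∑ i ∈ s, f i) :=
  Valuation.map_sum_le _ hf

lemma DegLE.ofPoly (P : MvPolynomial (Fin n) K) :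
    DegLE a (P.degreeOf a) (algebraMap _ (RatFun K n) P) := by
  unfold DegLE
  rw [degreeValuation_algebraMap]
  exact polyDegreeValuation_le a P

lemma algebraMap_C (c : K) :
    algebraMap (MvPolynomial (Fin n) K) (RatFun K n) (MvPolynomial.C c) =
      algebraMap K (RatFun K n) c :=
  (IsScalarTower.algebraMap_apply K (MvPolynomial (Fin n) K) (RatFun K n) c).symm

lemma DegLE.const (c : K) : DegLE a 0 (algebraMap K (RatFun K n) c) := by
  have := DegLE.ofPoly (a := a) (MvPolynomial.C c : MvPolynomial (Fin n) K)
  rwa [MvPolynomial.degreeOf_C, Nat.cast_zero, algebraMap_C] at this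

lemma DegLE.const_mul (c : K) (hg : DegLE a k g) :
    DegLE a k (algebraMap K (RatFun K n) c * g) := by
  simpa using (DegLE.const c).mul hg

lemma DegLE.of_const_mul {c : K} (hc : c ≠ 0) (hg : DegLE a k (algebraMap K (RatFun K n) c * g)) :
    DegLE a k g := by
  have := hg.const_mul c⁻¹
  rwa [← mul_assoc, ← map_mul, inv_mul_cancel₀ hc, map_one, one_mul] at this

lemma degreeValuation_z_self : degreeValuation K a (z a) = exp 1 := by
  rw [z, degreeValuation_algebraMap, polyDegreeValuation_apply a (MvPolynomial.X_ne_zero a)]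
  simp

lemma DegLE.z_self : DegLE a 1 (z a : RatFun K n) :=
  degreeValuation_z_self.le

lemma DegLE.z_ne {j : Fin n} (hj : a ≠ j) : DegLE a 0 (z j : RatFun K n) := by
  have := DegLE.ofPoly (a := a) (MvPolynomial.X j : MvPolynomial (Fin n) K)
  classical
  rwa [MvPolynomial.degreeOf_X, if_neg hj, Nat.cast_zero] at this

lemma z_ne_zero : (z a : RatFun K n) ≠ 0 := fun h => by
  have := degreeValuation_z_self (K := K) (a := a)
  rw [h, map_zero] at this
  exact exp_ne_zero this.symm

lemma DegLE.z_inv : DegLE a (-1) (z a : RatFun K n)⁻¹ := by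
  unfold DegLE
  rw [map_inv₀, degreeValuation_z_self, exp_neg]

lemma exists_degreeValuation_eq (hg : g ≠ 0) : ∃ d : ℤ, degreeValuation K a g = exp d :=
  ⟨log (degreeValuation K a g), (exp_log ((Valuation.ne_zero_iff _).2 hg)).symm⟩

/-- The degree of a product is the sum of the degrees. -/
lemma DegLE.of_mul {d : ℤ} (hg : degreeValuation K a g = exp d) (hgh : DegLE a k (g * h)) :
    DegLE a (k - d) h := by
  unfold DegLE at *
  rw [map_mul, hg] at hgh
  have h2 := mul_le_mul_right hgh (exp (-d))
  rwa [← mul_assoc, ← exp_add, ← exp_add, neg_add_cancel, exp_zero, one_mul,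
    neg_add_eq_sub] at h2

end Degree

/-! ### Translations and the degree -/

section Shift

open WithZero

variable {K : Type*} [Field K] {n : ℕ}

lemma shift_algebraMap (κ : K) (a : Fin n) (P : MvPolynomial (Fin n) K) :
    shift κ a (algebraMap _ (RatFun K n) P) = algebraMap _ (RatFun K n) (polyShiftHom κ a P) :=
  IsFractionRing.fieldEquivOfAlgEquiv_algebraMap ..

lemma shift_z (κ : K) (a i : Fin n) :
    shift κ a (z i) = z i - if i = a then algebraMap K (RatFun K n) κ else 0 := by
  rw [z, shift_algebraMap, polyShiftHom, MvPolynomial.aeval_X, map_sub]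
  split_ifs <;> simp [algebraMap_C]

lemma shift_const (κ : K) (a : Fin n) (c : K) :
    shift κ a (algebraMap K (RatFun K n) c) = algebraMap K (RatFun K n) c :=
  (shift κ a).commutes c

/-- `ShiftExpansion κ a k g` says that `g` has degree at most `k` in `z_a` and that
`g(z_a - κ) - g(z_a)` is `-k κ g / z_a` up to terms of degree at most `k - 2`. -/
structure ShiftExpansion (κ : K) (a : Fin n) (k : ℤ) (g : RatFun K n) : Prop where
  degLE : DegLE a k g
  shift_sub : DegLE a (k - 2)
    (shift κ a g - g + algebraMap K (RatFun K n) (k * κ) * (z a)⁻¹ * g)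

variable {κ : K} {a : Fin n} {k l : ℤ} {g h : RatFun K n}

/-- If `k < l`, changing the coefficient from `k` to `l` adds a multiple of `g / z_a`, of degree at
most `k - 1 ≤ l - 2`. So `k` need only bound the degree, which makes sums of monomials harmless. -/
lemma ShiftExpansion.mono (hg : ShiftExpansion κ a k g) (hkl : k ≤ l) :
    ShiftExpansion κ a l g := by
  refine ⟨hg.degLE.mono hkl, ?_⟩
  rcases hkl.eq_or_lt with rfl | hlt
  · exact hg.shift_sub
  have h1 : DegLE a (l - 2) (algebraMap K (RatFun K n) ((l - k) * κ) * ((z a)⁻¹ * g)) :=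
    DegLE.const_mul _ ((DegLE.z_inv.mul hg.degLE).mono (by omega))
  convert (hg.shift_sub.mono (by omega : k - 2 ≤ l - 2)).add h1 using 1
  simp only [map_mul, map_sub, map_intCast]
  ring

lemma ShiftExpansion.sum {ι : Type*} {s : Finset ι} {f : ι → RatFun K n}
    (hf : ∀ i ∈ s, ShiftExpansion κ a k (f i)) : ShiftExpansion κ a k (∑ i ∈ s, f i) := by
  refine ⟨DegLE.sum fun i hi => (hf i hi).degLE, ?_⟩
  rw [map_sum, Finset.mul_sum, ← Finset.sum_sub_distrib, ← Finset.sum_add_distrib]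
  exact DegLE.sum fun i hi => (hf i hi).shift_sub

lemma ShiftExpansion.degLE_sub (hg : ShiftExpansion κ a k g) :
    DegLE a (k - 1) (shift κ a g - g) := by
  have h1 : DegLE a (k - 1) (algebraMap K (RatFun K n) (k * κ) * ((z a)⁻¹ * g)) :=
    DegLE.const_mul _ ((DegLE.z_inv.mul hg.degLE).mono (by omega))
  convert (hg.shift_sub.mono (by omega : k - 2 ≤ k - 1)).sub h1 using 1
  ring

lemma ShiftExpansion.degLE_shift (hg : ShiftExpansion κ a k g) : DegLE a k (shift κ a g) := by
  convert (hg.degLE_sub.mono (by omega : k - 1 ≤ k)).add hg.degLE using 1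
  ring

/-- A Leibniz rule: the difference of a product splits as `(σg - g) σh + g (σh - h)`, where `σ` is
the translation. Replacing `σh` by `h` in the first-order term costs only second order (`h3`). -/
lemma ShiftExpansion.mul (hg : ShiftExpansion κ a k g) (hh : ShiftExpansion κ a l h) :
    ShiftExpansion κ a (k + l) (g * h) := by
  refine ⟨hg.degLE.mul hh.degLE, ?_⟩
  have h1 := hg.shift_sub.mul hh.degLE_shift
  have h2 := hg.degLE.mul hh.shift_sub
  have h3 : DegLE a (k + l - 2)
      (algebraMap K (RatFun K n) (k * κ) * ((z a)⁻¹ * (g * (shift κ a h - h)))) :=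
    DegLE.const_mul _ ((DegLE.z_inv.mul (hg.degLE.mul hh.degLE_sub)).mono (by omega))
  convert ((h1.mono (by omega : k - 2 + l ≤ k + l - 2)).add
    (h2.mono (by omega : k + (l - 2) ≤ k + l - 2))).sub h3 using 1
  simp only [map_mul, map_add, map_intCast, Int.cast_add]
  ring

lemma ShiftExpansion.const (c : K) : ShiftExpansion κ a 0 (algebraMap K (RatFun K n) c) := by
  refine ⟨DegLE.const c, ?_⟩
  simpa [shift_const] using DegLE.zero

lemma ShiftExpansion.var (i : Fin n) : ShiftExpansion κ a (if i = a then 1 else 0) (z i) := by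
  split_ifs with hi
  · subst hi
    refine ⟨DegLE.z_self, ?_⟩
    have : z i ≠ (0 : RatFun K n) := z_ne_zero
    have h0 : shift κ i (z i) - z i +
        algebraMap K (RatFun K n) ((1 : ℤ) * κ) * (z i)⁻¹ * z i = 0 := by
      rw [shift_z, if_pos rfl]
      field_simp
      simp
    rw [h0]
    exact DegLE.zero
  · refine ⟨DegLE.z_ne (Ne.symm hi), ?_⟩
    simpa [shift_z, hi] using DegLE.zero

lemma ShiftExpansion.pow {k : ℕ} (hg : ShiftExpansion κ a k g) (m : ℕ) :
    ShiftExpansion κ a (m * k : ℕ) (g ^ m) := by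
  induction m with
  | zero => simpa using ShiftExpansion.const (κ := κ) (a := a) 1
  | succ m ih =>
    rw [pow_succ, Nat.succ_mul, Nat.cast_add]
    exact ih.mul hg

lemma ShiftExpansion.prod {ι : Type*} {s : Finset ι} {f : ι → RatFun K n} {d : ι → ℕ}
    (hf : ∀ i ∈ s, ShiftExpansion κ a (d i) (f i)) :
    ShiftExpansion κ a (∑ i ∈ s, d i : ℕ) (∏ i ∈ s, f i) := by
  classical
  induction s using Finset.induction_on with
  | empty => simpa using ShiftExpansion.const (κ := κ) (a := a) 1
  | insert i s hi ih =>
    rw [Finset.prod_insert hi, Finset.sum_insert hi, Nat.cast_add]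
    exact (hf i (Finset.mem_insert_self i s)).mul
      (ih fun j hj => hf j (Finset.mem_insert_of_mem hj))

lemma ShiftExpansion.monomial (m : Fin n →₀ ℕ) (c : K) :
    ShiftExpansion κ a (m a) (algebraMap _ (RatFun K n) (MvPolynomial.monomial m c)) := by
  rw [MvPolynomial.monomial_eq, Finsupp.prod_fintype _ _ (fun i => pow_zero _), map_mul,
    algebraMap_C, map_prod]
  have h1 : ShiftExpansion κ a (∑ i : Fin n, m i * (if i = a then 1 else 0) : ℕ)
      (∏ i : Fin n, algebraMap (MvPolynomial (Fin n) K) (RatFun K n)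
        (MvPolynomial.X i ^ m i)) := by
    refine ShiftExpansion.prod fun i _ => ?_
    rw [map_pow]
    refine ShiftExpansion.pow ?_ _
    have := ShiftExpansion.var (κ := κ) (a := a) i
    push_cast
    exact this
  convert (ShiftExpansion.const c).mul h1 using 1
  simp

lemma ShiftExpansion.ofPoly (P : MvPolynomial (Fin n) K) :
    ShiftExpansion κ a (P.degreeOf a) (algebraMap _ (RatFun K n) P) := by
  conv => arg 4; rw [P.as_sum, map_sum]
  exact ShiftExpansion.sum fun m hm => (ShiftExpansion.monomial m _).mono
    (Nat.cast_le.2 (MvPolynomial.monomial_le_degreeOf a hm))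

lemma degreeValuation_shift_eq (hg : ShiftExpansion κ a k g)
    (hk : degreeValuation K a g = exp k) : degreeValuation K a (shift κ a g) = exp k := by
  have h1 : degreeValuation K a (shift κ a g - g) < degreeValuation K a g := by
    rw [hk]
    exact lt_of_le_of_lt hg.degLE_sub (exp_lt_exp.2 (by omega))
  have := Valuation.map_add_eq_of_lt_left _ h1
  rwa [add_sub_cancel, hk] at this

/-- A rational function of degree at most `k` has a two-term expansion of its translation. -/
lemma DegLE.shiftExpansion (hg : DegLE a k g) : ShiftExpansion κ a k g := by
  by_cases hg0 : g = 0
  · subst hg0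
    exact ⟨DegLE.zero, by simpa using DegLE.zero⟩
  obtain ⟨P, Q, hQ, rfl⟩ := IsFractionRing.div_surjective (MvPolynomial (Fin n) K) g
  have hQ0 : Q ≠ 0 := nonZeroDivisors.ne_zero hQ
  have hP0 : P ≠ 0 := fun h => hg0 (by simp [h])
  set G := algebraMap (MvPolynomial (Fin n) K) (RatFun K n) P with hG
  set H := algebraMap (MvPolynomial (Fin n) K) (RatFun K n) Q with hH
  have eG : ShiftExpansion κ a (P.degreeOf a) G := ShiftExpansion.ofPoly P
  have eH : ShiftExpansion κ a (Q.degreeOf a) H := ShiftExpansion.ofPoly Q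
  have vG : degreeValuation K a G = exp (P.degreeOf a : ℤ) := by
    rw [hG, degreeValuation_algebraMap, polyDegreeValuation_apply a hP0]
  have vH : degreeValuation K a H = exp (Q.degreeOf a : ℤ) := by
    rw [hH, degreeValuation_algebraMap, polyDegreeValuation_apply a hQ0]
  have vH' := degreeValuation_shift_eq eH vH
  generalize (P.degreeOf a : ℤ) = p at *
  generalize (Q.degreeOf a : ℤ) = q at *
  have vquot : degreeValuation K a (G / H) = exp (p - q) := by
    rw [map_div₀, vG, vH, exp_sub]
  have hle : p - q ≤ k := by
    have := hg
    rw [DegLE, vquot, exp_le_exp] at this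
    exact this
  refine ShiftExpansion.mono ⟨vquot.le, ?_⟩ hle
  have hH0 : H ≠ 0 := fun h => by rw [h, map_zero] at vH; exact exp_ne_zero vH.symm
  have hH0' : shift κ a H ≠ 0 := fun h => by rw [h, map_zero] at vH'; exact exp_ne_zero vH'.symm
  have vHH : degreeValuation K a (H * shift κ a H) = exp (q + q) := by
    rw [map_mul, vH, vH', exp_add]
  have h1 := eG.shift_sub.mul eH.degLE
  have h2 := eG.degLE.mul eH.shift_sub
  have h3 : DegLE a (p + q - 2)
      (algebraMap K (RatFun K n) ((p - q) * κ) * ((z a)⁻¹ * (G * (shift κ a H - H)))) :=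
    DegLE.const_mul _ ((DegLE.z_inv.mul (eG.degLE.mul eH.degLE_sub)).mono (by omega))
  have h4 := ((h1.mono (by omega : p - 2 + q ≤ p + q - 2)).sub
    (h2.mono (by omega : p + (q - 2) ≤ p + q - 2))).add h3
  -- Clear the denominator `H * shift κ a H` of degree `2q`; the target degree `p - q - 2` becomes
  -- `p + q - 2`.
  refine (DegLE.of_mul vHH (k := p + q - 2) ?_).mono (by omega)
  convert h4 using 1
  rw [map_div₀]
  have hz : z a ≠ (0 : RatFun K n) := z_ne_zero
  simp only [map_mul, map_sub, map_intCast, Int.cast_sub]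
  field_simp
  ring

end Shift

/-! ### Coordinates -/

section Coordinates

variable (K : Type*) [Field K] {n : ℕ}

/-- The coordinate functional on `L^{⊗ n}` dual to `v_I`. -/
def coordI (I : Finset (Fin n)) : TensorPow K n →ₗ[K] K :=
  PiTensorProduct.lift ((MultilinearMap.mkPiAlgebra K (Fin n) K).compLinearMap
    fun j => LinearMap.proj (if j ∈ I then 1 else 0))

variable {K}

lemma coordI_tprod (I : Finset (Fin n)) (x : Fin n → L K) :
    coordI K I (PiTensorProduct.tprod K x) = ∏ j, x j (if j ∈ I then 1 else 0) := by
  simp [coordI]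

lemma coordI_vI (I J : Finset (Fin n)) : coordI K I (vI K J) = if I = J then 1 else 0 := by
  rw [vI, coordI_tprod]
  split_ifs with h
  · subst h
    refine Finset.prod_eq_one fun j _ => ?_
    by_cases hj : j ∈ I <;> simp [hj, v₁, v₂]
  · obtain ⟨j, hj⟩ : ∃ j, ¬ (j ∈ I ↔ j ∈ J) := by
      by_contra! h'
      exact h (Finset.ext h')
    refine Finset.prod_eq_zero (Finset.mem_univ j) ?_
    by_cases h1 : j ∈ I <;> by_cases h2 : j ∈ J <;> simp_all [v₁, v₂]

/-- The coordinate of a vector at `v_{i}`. -/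
abbrev coord (i : Fin n) : TensorPow K n →ₗ[K] K := coordI K {i}

lemma coord_perm (a b i : Fin n) (x : TensorPow K n) :
    coord i (perm K a b x) = coord (Equiv.swap a b i) x := by
  have : coord i ∘ₗ perm K a b = coord (K := K) (Equiv.swap a b i) := by
    refine PiTensorProduct.ext (MultilinearMap.ext fun y => ?_)
    simp only [LinearMap.compMultilinearMap_apply, LinearMap.comp_apply, perm,
      LinearEquiv.coe_coe, PiTensorProduct.reindex_tprod, coordI_tprod, Finset.mem_singleton,
      Equiv.symm_swap]
    refine Fintype.prod_equiv (Equiv.swap a b) _ _ fun j => ?_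
    simp
  exact LinearMap.congr_fun this x

/-- Only the `v_{i}` are sent by `e` to a vector with a `v_∅` component, each with coefficient one.
This turns singularity into the vanishing of the sum of coordinates. -/
lemma coordI_empty_eTensor (x : TensorPow K n) :
    coordI K ∅ (eTensor K n x) = ∑ i, coord i x := by
  have : coordI K ∅ ∘ₗ eTensor K n = ∑ i, coord (K := K) i := by
    refine PiTensorProduct.ext (MultilinearMap.ext fun y => ?_)
    simp only [LinearMap.compMultilinearMap_apply, LinearMap.comp_apply, eTensor,
      LinearMap.sum_apply, map_sum, PiTensorProduct.map_tprod, coordI_tprod]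
    refine Finset.sum_congr rfl fun i _ => Finset.prod_congr rfl fun j _ => ?_
    by_cases hj : j = i
    · subst hj
      simp [eL, v₁]
    · simp [hj]
  simpa using LinearMap.congr_fun this x

lemma sum_coord_of_mem_sing {l : ℕ} {x : TensorPow K n} (hx : x ∈ sing K n l) :
    ∑ i, coord i x = 0 := by
  rw [← coordI_empty_eTensor, LinearMap.mem_ker.1 hx.2, map_zero]

lemma eq_sum_coord_of_mem_weightSpace {x : TensorPow K n} (hx : x ∈ weightSpace K n 1) :
    x = ∑ i, coord i x • vI K {i} := by
  induction hx using Submodule.span_induction with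
  | mem x hx =>
    obtain ⟨I, hI, rfl⟩ := hx
    obtain ⟨i, rfl⟩ := Finset.card_eq_one.1 hI
    simp [coordI_vI]
  | zero => simp
  | add x y _ _ hx hy =>
    simp only [map_add, add_smul, Finset.sum_add_distrib]
    rw [← hx, ← hy]
  | smul c x _ hx =>
    simp only [map_smul, smul_eq_mul, mul_smul]
    rw [← Finset.smul_sum, ← hx]

/-- The coordinate at `v_{i}` of a rational vector-valued function. -/
def coordFun (i : Fin n) : VecFun K n →ₗ[RatFun K n] RatFun K n :=
  (TensorProduct.AlgebraTensorModule.rid K (RatFun K n) (RatFun K n)).toLinearMap ∘ₗ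
    (coord i).baseChange (RatFun K n)

lemma coordFun_tmul (i : Fin n) (g : RatFun K n) (x : TensorPow K n) :
    coordFun i (g ⊗ₜ x) = algebraMap K (RatFun K n) (coord i x) * g := by
  simp [coordFun, Algebra.smul_def]

lemma coordFun_vecShift (κ : K) (a i : Fin n) (s : VecFun K n) :
    coordFun i (vecShift κ a s) = shift κ a (coordFun i s) := by
  induction s using TensorProduct.induction_on with
  | zero => simp
  | tmul g x => simp [vecShift, coordFun_tmul]
  | add s t hs ht => simp only [map_add, hs, ht]

lemma coordFun_perm (a b i : Fin n) (s : VecFun K n) :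
    coordFun i ((perm K a b).baseChange (RatFun K n) s) = coordFun (Equiv.swap a b i) s := by
  induction s using TensorProduct.induction_on with
  | zero => simp
  | tmul g x => simp only [LinearMap.baseChange_tmul, coordFun_tmul, coord_perm]
  | add s t hs ht => simp only [map_add, hs, ht]

lemma singFun_induction {motive : VecFun K n → Prop} {s : VecFun K n} (hs : s ∈ singFun K n)
    (tmul : ∀ x ∈ sing K n 1, motive (1 ⊗ₜ x)) (zero : motive 0)
    (add : ∀ s t, motive s → motive t → motive (s + t))
    (smul : ∀ (g : RatFun K n) s, motive s → motive (g • s)) : motive s := by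
  rw [singFun, Submodule.baseChange_eq_span] at hs
  induction hs using Submodule.span_induction with
  | mem x hx =>
    obtain ⟨y, hy, rfl⟩ := hx
    exact tmul y hy
  | zero => exact zero
  | add s t _ _ hs ht => exact add s t hs ht
  | smul g s _ hs => exact smul g s hs

lemma sum_coordFun_of_mem_singFun {s : VecFun K n} (hs : s ∈ singFun K n) :
    ∑ i, coordFun i s = 0 := by
  refine singFun_induction (motive := fun s => ∑ i, coordFun i s = 0) hs
    (fun x hx => ?_) (by simp) (fun s t hs ht => ?_) fun g s hs => ?_
  · simp only [coordFun_tmul, mul_one]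
    rw [← map_sum, sum_coord_of_mem_sing hx, map_zero]
  · simp only [map_add, Finset.sum_add_distrib, hs, ht, add_zero]
  · simp only [map_smul, ← Finset.smul_sum, hs, smul_zero]

lemma eq_sum_coordFun_of_mem_singFun {s : VecFun K n} (hs : s ∈ singFun K n) :
    s = ∑ i, coordFun i s • ((1 : RatFun K n) ⊗ₜ[K] vI K {i}) := by
  refine singFun_induction
    (motive := fun s => s = ∑ i, coordFun i s • ((1 : RatFun K n) ⊗ₜ[K] vI K {i})) hs
    (fun x hx => ?_) (by simp) (fun s t hs ht => ?_) fun g s hs => ?_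
  · conv_lhs => rw [eq_sum_coord_of_mem_weightSpace hx.1, TensorProduct.tmul_sum]
    refine Finset.sum_congr rfl fun i _ => ?_
    rw [coordFun_tmul, mul_one, TensorProduct.tmul_smul, algebraMap_smul]
  · simp only [map_add, add_smul, Finset.sum_add_distrib]
    rw [← hs, ← ht]
  · simp only [map_smul, smul_assoc]
    rw [← Finset.smul_sum, ← hs]

/-- Rests on `(u - P) / (u - 1) = 1 + (1 - P) / (u - 1)`, which isolates the correction to the
identity at infinity. -/
lemma coordFun_R (a j i : Fin n) {u : RatFun K n} (hu : u - 1 ≠ 0) (s : VecFun K n) :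
    coordFun i (R a j u s) =
      coordFun i s + (u - 1)⁻¹ * (coordFun i s - coordFun (Equiv.swap a j i) s) := by
  have h : coordFun i (R a j u s) =
      (u - 1)⁻¹ * (u * coordFun i s - coordFun (Equiv.swap a j i) s) := by
    simp [R, coordFun_perm]
  rw [h]
  field_simp
  ring

end Coordinates

/-! ### The qKZ operator at infinity -/

section Infinity

open WithZero

variable {K : Type*} [Field K] {n : ℕ} {a : Fin n} {d : ℤ}

/-- If `g` has degree at most zero in `z_a`, then `z_a - g` has degree exactly one in `z_a`. -/
lemma degreeValuation_z_sub {g : RatFun K n} (hg : DegLE a 0 g) :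
    degreeValuation K a (z a - g) = exp 1 := by
  rw [← degreeValuation_z_self (K := K) (a := a)]
  refine Valuation.map_sub_eq_of_lt_left _ ?_
  rw [degreeValuation_z_self]
  exact lt_of_le_of_lt hg (exp_lt_exp.2 (by omega))

lemma z_sub_ne_zero {g : RatFun K n} (hg : DegLE a 0 g) : z a - g ≠ 0 := fun h => by
  have := degreeValuation_z_sub hg
  rw [h, map_zero] at this
  exact exp_ne_zero this.symm

lemma DegLE.z_sub_inv {g : RatFun K n} (hg : DegLE a 0 g) : DegLE a (-1) (z a - g)⁻¹ := by
  unfold DegLE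
  rw [map_inv₀, degreeValuation_z_sub hg, exp_neg]

lemma DegLE.z_sub_inv_sub {g : RatFun K n} (hg : DegLE a 0 g) :
    DegLE a (-2) ((z a - g)⁻¹ - (z a)⁻¹) := by
  have h0 := z_sub_ne_zero hg
  have h1 : z a ≠ (0 : RatFun K n) := z_ne_zero
  convert ((hg.z_sub_inv.mul DegLE.z_inv).mul hg).mono (by omega : -1 + -1 + 0 ≤ (-2 : ℤ)) using 1
  field_simp
  ring

/-- The product of `R^{(a,j)}(z_a - z_j)` over a list of indices `j ≠ a` is
`1 + ∑_j (1 - P^{(a,j)}) / z_a` up to terms of relative degree at most `-2`. -/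
lemma degLE_coordFun_prod_R (s : VecFun K n) (hs : ∀ i, DegLE a d (coordFun i s))
    (l : List (Fin n)) (hl : ∀ j ∈ l, a ≠ j) (i : Fin n) :
    DegLE a (d - 2) (coordFun i ((l.map fun j => R a j (z a - z j)).prod s) - coordFun i s -
      (z a)⁻¹ * (l.map fun j => coordFun i s - coordFun (Equiv.swap a j i) s).sum) := by
  induction l generalizing i with
  | nil => simpa using DegLE.zero
  | cons j l ih =>
    have hj : DegLE a 0 (z j + 1 : RatFun K n) := by
      refine (DegLE.z_ne (hl j (by simp))).add ?_
      simpa using DegLE.const (K := K) (n := n) (a := a) 1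
    have hu : z a - z j - 1 = (z a - (z j + 1) : RatFun K n) := by ring
    simp only [List.map_cons, List.prod_cons, List.sum_cons, Module.End.mul_apply]
    rw [coordFun_R _ _ _ (hu ▸ z_sub_ne_zero hj), hu]
    have ih' := fun i => ih (fun j hj => hl j (List.mem_cons_of_mem _ hj)) i
    set w := (l.map fun j => R a j (z a - z j)).prod s
    have hsum : ∀ i, DegLE a d
        (l.map fun j => coordFun i s - coordFun (Equiv.swap a j i) s).sum := by
      intro i
      clear ih ih' hl w
      induction l with
      | nil => simpa using DegLE.zero
      | cons j l ih =>
        rw [List.map_cons, List.sum_cons]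
        exact ((hs _).sub (hs _)).add ih
    -- The new factor's correction already carries degree `-1`, so in it `w` may be replaced by `s`,
    -- and likewise `(z a - (z j + 1))⁻¹` by `(z a)⁻¹`.
    have hw : ∀ i, DegLE a (d - 1) (coordFun i w - coordFun i s) := by
      intro i
      have h1 := (DegLE.z_inv.mul (hsum i)).mono (by omega : -1 + d ≤ d - 1)
      convert ((ih' i).mono (by omega : d - 2 ≤ d - 1)).add h1 using 1
      ring
    set i' := Equiv.swap a j i
    have h1 := (hj.z_sub_inv.mul ((hw i).sub (hw i'))).mono (by omega : -1 + (d - 1) ≤ d - 2)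
    have h2 := (hj.z_sub_inv_sub.mul ((hs i).sub (hs i'))).mono (by omega : -2 + d ≤ d - 2)
    convert ((ih' i).add h1).add h2 using 1
    ring

lemma qKZOp_eq_of_isMin (κ : K) (ha : ∀ j, a ≤ j) :
    qKZOp κ a = (((List.finRange n).filter (fun j => a < j)).reverse.map
      fun j => R a j (z a - z j)).prod := by
  have : (List.finRange n).filter (fun j => j < a) = [] := by
    simpa [List.filter_eq_nil_iff] using ha
  rw [qKZOp, this]
  simp

lemma sum_map_filter_lt {M : Type*} [AddCommMonoid M] (ha : ∀ j, a ≤ j) (F : Fin n → M) :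
    (((List.finRange n).filter (fun j => a < j)).reverse.map F).sum =
      ∑ j ∈ Finset.univ.erase a, F j := by
  rw [List.map_reverse, List.sum_reverse, ← List.sum_toFinset _ ((List.nodup_finRange n).filter _)]
  refine Finset.sum_congr (Finset.ext fun j => ?_) fun _ _ => rfl
  simpa using ⟨fun h => h.ne', fun h => lt_of_le_of_ne (ha j) (Ne.symm h)⟩

lemma sum_sub_swap_self (f : Fin n → RatFun K n) (hf : ∑ i, f i = 0) :
    ∑ j ∈ Finset.univ.erase a, (f a - f (Equiv.swap a j a)) = n * f a := by
  simp only [Equiv.swap_apply_left]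
  rw [← Finset.sum_erase_add _ _ (Finset.mem_univ a)] at hf
  have hn : ((n - 1 : ℕ) : RatFun K n) = n - 1 := by
    rw [Nat.cast_sub (by have := a.pos; omega), Nat.cast_one]
  rw [Finset.sum_sub_distrib, Finset.sum_const, Finset.card_erase_of_mem (Finset.mem_univ a),
    Finset.card_univ, Fintype.card_fin, nsmul_eq_mul, hn]
  linear_combination -hf

lemma sum_sub_swap_of_ne (f : Fin n → RatFun K n) {i : Fin n} (hi : i ≠ a) :
    ∑ j ∈ Finset.univ.erase a, (f i - f (Equiv.swap a j i)) = f i - f a := by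
  rw [Finset.sum_eq_single_of_mem i (by simp [hi])]
  · simp
  · intro j _ hj
    rw [Equiv.swap_apply_of_ne_of_ne hi hj.symm, sub_self]

/-- The leading terms at `z_a = ∞` of the qKZ equation for the first index. -/
lemma IsSolution.degLE_leading {κ : K} {s : VecFun K n} (hsol : IsSolution κ s)
    (ha : ∀ j, a ≤ j) (hs : ∀ i, DegLE a d (coordFun i s)) (i : Fin n) :
    DegLE a (d - 1) (∑ j ∈ Finset.univ.erase a, (coordFun i s - coordFun (Equiv.swap a j i) s) +
      algebraMap K (RatFun K n) (d * κ) * coordFun i s) := by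
  have h1 := degLE_coordFun_prod_R s hs ((List.finRange n).filter (fun j => a < j)).reverse
    (fun j hj => by
      have : a < j := by simpa using hj
      exact this.ne) i
  rw [← qKZOp_eq_of_isMin κ ha, ← hsol a, coordFun_vecShift, sum_map_filter_lt ha] at h1
  have h2 := ((hs i).shiftExpansion (κ := κ)).shift_sub
  -- Both expansions describe the same translated coordinate; subtracting cancels it, and
  -- multiplying by `z a` removes the common factor `(z a)⁻¹`.
  have h3 := (DegLE.z_self.mul (h2.sub h1)).mono (by omega : 1 + (d - 2) ≤ d - 1)
  convert h3 using 1
  have : z a ≠ (0 : RatFun K n) := z_ne_zero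
  field_simp
  ring

/-- If `d` is invertible in `K`, vanishing would give `κ = -m / d` in the prime field; if `p ∣ d`,
only `m` remains. -/
lemma natCast_add_intCast_mul_ne_zero {p : ℕ} [CharP K p] {κ : K}
    (hκ : κ ∉ (ZMod.castHom (dvd_refl p) K).range) {m : ℕ} (hm : (m : K) ≠ 0) (hp : p.Prime) :
    (m : K) + d * κ ≠ 0 := by
  have := Fact.mk hp
  intro h
  by_cases hd : (d : K) = 0
  · rw [hd, zero_mul, add_zero] at h
    exact hm h
  · refine hκ ⟨-(m : ZMod p) * (d : ZMod p)⁻¹, ?_⟩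
    rw [map_mul, map_neg, map_natCast, map_inv₀, map_intCast]
    field_simp
    linear_combination -h

end Infinity

end QKZ

end

theorem theorem1p1 (p n : ℕ) (hp : p.Prime) (hn : 1 < n) (hpn : ¬ p ∣ n)
    (K : Type*) [Field K] [CharP K p] (κ : K)
    (hκ : κ ∉ (ZMod.castHom (dvd_refl p) K).range) :
    ¬ ∃ s : QKZ.VecFun K n, s ∈ QKZ.singFun K n ∧ s ≠ 0 ∧ QKZ.IsSolution κ s := by
  open QKZ in
  rintro ⟨s, hs, hs0, hsol⟩
  have hsum := sum_coordFun_of_mem_singFun hs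
  let a : Fin n := ⟨0, by omega⟩
  have ha : ∀ j, a ≤ j := fun j => Nat.zero_le _
  -- The coordinate `m` attains the maximal degree `d`; the contradiction will be that its degree is
  -- at most `d - 1`.
  obtain ⟨m, -, hm⟩ := Finset.exists_max_image Finset.univ
    (fun i => degreeValuation K a (coordFun i s)) ⟨a, Finset.mem_univ a⟩
  have hm0 : coordFun m s ≠ 0 := fun h => by
    refine hs0 ((eq_sum_coordFun_of_mem_singFun hs).trans (Finset.sum_eq_zero fun i hi => ?_))
    have := hm i hi
    rw [h, map_zero, le_zero_iff, map_eq_zero] at this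
    rw [this, zero_smul]
  obtain ⟨d, hd⟩ := exists_degreeValuation_eq (a := a) hm0
  have hdeg : ∀ i, DegLE a d (coordFun i s) := fun i => (hm i (Finset.mem_univ i)).trans_eq hd
  have hlead := hsol.degLE_leading ha hdeg
  have hfa : DegLE a (d - 1) (coordFun a s) := by
    refine DegLE.of_const_mul (natCast_add_intCast_mul_ne_zero (d := d) hκ
      (mt (CharP.cast_eq_zero_iff K p n).1 hpn) hp) ?_
    have := hlead a
    rw [sum_sub_swap_self (fun i => coordFun i s) hsum] at this
    convert this using 1
    simp only [map_add, map_natCast]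
    ring
  -- For `m ≠ a` the leading equation involves `f m - f a`; the drop for `f a`, just obtained,
  -- leaves `(1 + d κ) f m`.
  have hfm : DegLE a (d - 1) (coordFun m s) := by
    by_cases hma : m = a
    · rwa [hma]
    refine DegLE.of_const_mul (natCast_add_intCast_mul_ne_zero (d := d) (m := 1) hκ
      (by simp) hp) ?_
    have := (hlead m).add hfa
    rw [sum_sub_swap_of_ne (fun i => coordFun i s) hma] at this
    convert this using 1
    simp only [map_add, Nat.cast_one, map_one]
    ring
  rw [DegLE, hd, WithZero.exp_le_exp] at hfm
  omega
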